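/- Let $K$ be a number field with exactly $s>0$ real embeddings $\sigma_1,\dots,\sigma_s$ and $2t>0$ non-real complex embeddings, from which $\sigma_{s+1},\dots,\sigma_{s+t}$ are chosen, one out of each complex conjugate pair. Let $U$ be an admissible group of units of the ring of integers $O_K$, that is, a subgroup of $\{u\in O_K^*:\sigma_i(u)>0,\ 1\le i\le s\}$ of rank $s$ such that $\{(\ln\sigma_1(u),\dots,\ln\sigma_s(u)) : u\in U\}$ is a lattice (a discrete subgroup spanning the space) in $\mathbb R^s$. Let $M=(\mathbb H^s\times\mathbb C^t)/(U\ltimes O_K)$ be the corresponding Oeljeklaus–Toma manifold, where $\mathbb H$ is the upper half-plane, $(u,a)\in U\ltimes O_K$ acts by $(z_k)_{k}\mapsto(\sigma_k(u)z_k+\sigma_k(a))_{k}$, $1\le k\le s+t$, and $M$ carries the complex structure for which the projection $\mathbb H^s\times\mathbb C^t\to M$ is a local biholomorphism. Then there are no compact complex curves on $M$: $M$ contains no non-empty compact complex submanifold of dimension $1$. Moreover (so that singular parametrized curves are excluded as well), every holomorphic map from a compact connected Riemann surface to $M$ is constant. -/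

import Mathlib

open scoped Manifold ContDiff NumberField

noncomputable section

namespace OeljeklausToma

/-- A numbering of the embeddings of a number field `K` having exactly `s` real and `2t` complex
embeddings: `realEmb` lists all real embeddings, and `complexEmb` contains exactly one
embedding out of each pair of complex conjugate non-real embeddings. -/
structure EmbeddingNumbering (K : Type*) [Field K] [NumberField K] (s t : ℕ) where
  /-- the real embeddings `σ₁, …, σ_s` -/
  realEmb : Fin s ≃ (K →+* ℝ)
  /-- the complex embeddings `σ_{s+1}, …, σ_{s+t}` -/
  complexEmb : Fin t → (K →+* ℂ)
  complexEmb_not_isReal : ∀ j, ¬ NumberField.ComplexEmbedding.IsReal (complexEmb j)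
  existsUnique_complexEmb : ∀ φ : K →+* ℂ, ¬ NumberField.ComplexEmbedding.IsReal φ →
    ∃! j, φ = complexEmb j ∨ φ = NumberField.ComplexEmbedding.conjugate (complexEmb j)

variable {K : Type*} [Field K] [NumberField K] {s t : ℕ}

/-- The embeddings `σ₁, …, σ_{s+t}`, all regarded as maps to `ℂ`. -/
def EmbeddingNumbering.emb (σ : EmbeddingNumbering K s t) : Fin s ⊕ Fin t → (K →+* ℂ) :=
  Sum.elim (fun i => Complex.ofRealHom.comp (σ.realEmb i)) σ.complexEmb

/-- The logarithmic map `l(u) = (ln|σ₁ u|, …, ln|σ_s u|, 2 ln|σ_{s+1} u|, …, 2 ln|σ_{s+t} u|)`. -/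
def EmbeddingNumbering.logMap (σ : EmbeddingNumbering K s t) :
    Additive (𝓞 K)ˣ →+ (Fin s ⊕ Fin t → ℝ) where
  toFun u := Sum.elim
    (fun i => Real.log |σ.realEmb i ((u.toMul : 𝓞 K) : K)|)
    (fun j => 2 * Real.log ‖σ.complexEmb j ((u.toMul : 𝓞 K) : K)‖)
  map_zero' := by
    ext k
    cases k <;> simp
  map_add' u v := by
    ext k
    cases k
    · simp [abs_mul, Real.log_mul]
    · simp [Real.log_mul, mul_add]

/-- The projection of `ℝ^{s+t}` to the first `s` components. -/
def projFirst (s t : ℕ) : (Fin s ⊕ Fin t → ℝ) →+ (Fin s → ℝ) where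
  toFun x i := x (Sum.inl i)
  map_zero' := rfl
  map_add' _ _ := rfl

/-- The image of `l(U)` under the projection to the first `s` components. -/
def EmbeddingNumbering.logImage (σ : EmbeddingNumbering K s t) (U : Subgroup (𝓞 K)ˣ) :
    AddSubgroup (Fin s → ℝ) :=
  U.toAddSubgroup.map ((projFirst s t).comp σ.logMap)

/-- A lattice in `ℝⁿ`: a discrete additive subgroup which spans `ℝⁿ` over `ℝ`. -/
def IsLattice {n : ℕ} (L : AddSubgroup (Fin n → ℝ)) : Prop :=
  DiscreteTopology L ∧ Submodule.span ℝ (L : Set (Fin n → ℝ)) = ⊤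

/-- A group `U` of units is admissible if it consists of totally positive units, has rank `s`,
and the projection of `l(U)` to the first `s` components is a lattice in `ℝ^s`. -/
structure IsAdmissible (σ : EmbeddingNumbering K s t) (U : Subgroup (𝓞 K)ˣ) : Prop where
  pos : ∀ u ∈ U, ∀ i, 0 < σ.realEmb i ((u : 𝓞 K) : K)
  rank_eq : Module.finrank ℤ (Additive U) = s
  isLattice : IsLattice (σ.logImage U)

/-- The input of the Oeljeklaus–Toma construction: a number field with `s > 0` real and `2t > 0`
complex embeddings, numbered, and an admissible group of units. -/
structure OTData (K : Type*) [Field K] [NumberField K] (s t : ℕ) extends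
    EmbeddingNumbering K s t where
  s_pos : 0 < s
  t_pos : 0 < t
  /-- the admissible group of units -/
  U : Subgroup (𝓞 K)ˣ
  admissible : IsAdmissible toEmbeddingNumbering U

/-- The domain `ℍ^s × ℂ^t` in `ℂ^{s+t}`. -/
def domain (s t : ℕ) : TopologicalSpace.Opens (Fin s ⊕ Fin t → ℂ) where
  carrier := {z | ∀ i : Fin s, 0 < (z (Sum.inl i)).im}
  is_open' := by
    simp only [Set.ofPred_forall]
    exact isOpen_iInter_of_finite fun i =>
      isOpen_lt continuous_const (Complex.continuous_im.comp (continuous_apply _))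

namespace OTData

/-- The multiplicative action of `U` on the additive group of `𝓞 K`. -/
def unitsAction (D : OTData K s t) : D.U →* MulAut (Multiplicative (𝓞 K)) :=
  ((MulAutMultiplicative (𝓞 K)).symm.toMonoidHom.comp
    (DistribMulAction.toAddAut (𝓞 K)ˣ (𝓞 K))).comp D.U.subtype

/-- The group `Γ = U ⋉ O_K`. -/
abbrev Gamma (D : OTData K s t) : Type _ := Multiplicative (𝓞 K) ⋊[D.unitsAction] D.U

/-- The unit component of an element of `U ⋉ O_K`, as an element of `K`. -/
def unitPart (D : OTData K s t) (γ : D.Gamma) : K := (((γ.right : (𝓞 K)ˣ) : 𝓞 K) : K)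

/-- The translation component of an element of `U ⋉ O_K`, as an element of `K`. -/
def transPart (D : OTData K s t) (γ : D.Gamma) : K := ((γ.left.toAdd : 𝓞 K) : K)

/-- The affine map `z ↦ (σ_k(u) z_k + σ_k(a))_k` of `ℂ^{s+t}` given by `(u, a) ∈ U ⋉ O_K`. -/
def affine (D : OTData K s t) (γ : D.Gamma) (z : Fin s ⊕ Fin t → ℂ) : Fin s ⊕ Fin t → ℂ :=
  fun k => D.emb k (D.unitPart γ) * z k + D.emb k (D.transPart γ)

lemma affine_inl_im (D : OTData K s t) (γ : D.Gamma) (z : Fin s ⊕ Fin t → ℂ) (i : Fin s) :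
    (D.affine γ z (Sum.inl i)).im = D.realEmb i (D.unitPart γ) * (z (Sum.inl i)).im := by
  simp [affine, EmbeddingNumbering.emb]

lemma unitPart_pos (D : OTData K s t) (γ : D.Gamma) (i : Fin s) :
    0 < D.realEmb i (D.unitPart γ) :=
  D.admissible.pos _ γ.right.2 i

lemma affine_mem (D : OTData K s t) (γ : D.Gamma) {z : Fin s ⊕ Fin t → ℂ}
    (hz : z ∈ domain s t) : D.affine γ z ∈ domain s t := fun i => by
  rw [affine_inl_im]
  exact mul_pos (D.unitPart_pos γ i) (hz i)

lemma unitPart_mul (D : OTData K s t) (γ δ : D.Gamma) :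
    D.unitPart (γ * δ) = D.unitPart γ * D.unitPart δ := by
  simp [unitPart]

lemma transPart_mul (D : OTData K s t) (γ δ : D.Gamma) :
    D.transPart (γ * δ) = D.transPart γ + D.unitPart γ * D.transPart δ := by
  simp only [transPart, SemidirectProduct.mul_left, toAdd_mul, map_add, add_right_inj]
  exact map_mul (algebraMap (𝓞 K) K) _ _

/-- The action of `U ⋉ O_K` on `ℍ^s × ℂ^t`. -/
instance mulAction (D : OTData K s t) : MulAction D.Gamma (domain s t) where
  smul γ z := ⟨D.affine γ z, D.affine_mem γ z.2⟩
  one_smul z := by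
    apply Subtype.ext
    funext k
    change D.affine 1 z k = _
    simp [affine, unitPart, transPart]
  mul_smul γ δ z := by
    apply Subtype.ext
    funext k
    change D.affine (γ * δ) z k = D.affine γ (D.affine δ z) k
    simp only [affine, unitPart_mul, transPart_mul, map_mul, map_add]
    ring

lemma coe_smul (D : OTData K s t) (γ : D.Gamma) (z : domain s t) :
    ((γ • z : domain s t) : Fin s ⊕ Fin t → ℂ) = D.affine γ z := rfl

lemma contDiff_affine (D : OTData K s t) (γ : D.Gamma) : ContDiff ℂ ω (D.affine γ) := by
  unfold affine
  fun_prop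

instance continuousConstSMul (D : OTData K s t) : ContinuousConstSMul D.Gamma (domain s t) where
  continuous_const_smul γ := by
    refine Continuous.subtype_mk ?_ _
    exact (D.contDiff_affine γ).continuous.comp continuous_subtype_val

lemma gamma_ext (D : OTData K s t) {γ δ : D.Gamma} (h₁ : D.unitPart γ = D.unitPart δ)
    (h₂ : D.transPart γ = D.transPart δ) : γ = δ := by
  refine SemidirectProduct.ext ?_ ?_
  · exact Multiplicative.toAdd.injective (NumberField.RingOfIntegers.ext h₂)
  · exact Subtype.ext (Units.ext (NumberField.RingOfIntegers.ext h₁))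

/-- The action is free. -/
instance isCancelSMul (D : OTData K s t) : IsCancelSMul D.Gamma (domain s t) where
  right_cancel' γ δ z h := by
    have h' : D.affine γ z = D.affine δ z := congrArg Subtype.val h
    let i : Fin s := ⟨0, D.s_pos⟩
    have hi : D.unitPart γ = D.unitPart δ := by
      have h1 := congrArg Complex.im (congrFun h' (Sum.inl i))
      rw [affine_inl_im, affine_inl_im] at h1
      exact (D.realEmb i).injective (mul_right_cancel₀ (z.2 i).ne' h1)
    refine D.gamma_ext hi ?_
    have h2 := congrFun h' (Sum.inl i)
    simp only [affine, hi, add_right_inj] at h2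
    exact (D.emb _).injective h2

lemma exists_norm_emb_eq (σ : EmbeddingNumbering K s t) (φ : K →+* ℂ) :
    ∃ k, ∀ x, ‖φ x‖ = ‖σ.emb k x‖ := by
  by_cases hφ : NumberField.ComplexEmbedding.IsReal φ
  · obtain ⟨i, hi⟩ := σ.realEmb.surjective hφ.embedding
    refine ⟨Sum.inl i, fun x => ?_⟩
    simp [EmbeddingNumbering.emb, hi]
  · obtain ⟨j, hj | hj, -⟩ := σ.existsUnique_complexEmb φ hφ
    · exact ⟨Sum.inr j, fun x => by simp [EmbeddingNumbering.emb, hj]⟩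
    · exact ⟨Sum.inr j, fun x => by
        simp [EmbeddingNumbering.emb, hj, NumberField.ComplexEmbedding.conjugate_coe_eq]⟩

/-- Elements of `O_K` with bounded embeddings are finite in number. -/
lemma finite_transPart (σ : EmbeddingNumbering K s t) (B : ℝ) :
    {x : K | IsIntegral ℤ x ∧ ∀ k, ‖σ.emb k x‖ ≤ B}.Finite := by
  refine (NumberField.Embeddings.finite_of_norm_le K ℂ B).subset ?_
  rintro x ⟨hx, hB⟩
  refine ⟨hx, fun φ => ?_⟩
  obtain ⟨k, hk⟩ := exists_norm_emb_eq σ φ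
  rw [hk]
  exact hB k

/-- Elements of `U` with bounded logarithms at the real places are finite in number. -/
lemma finite_unitPart (D : OTData K s t) (B : ℝ) :
    {u : (𝓞 K)ˣ | u ∈ D.U ∧ ∀ i, |Real.log (D.realEmb i ((u : 𝓞 K) : K))| ≤ B}.Finite := by
  have := D.admissible.isLattice.1
  have hfin : (Metric.closedBall (0 : Fin s → ℝ) B ∩ (D.logImage D.U : Set (Fin s → ℝ))).Finite :=
    Metric.finite_isBounded_inter_isClosed (isDiscrete_iff_discreteTopology.mpr this)
      Metric.isBounded_closedBall
      (AddSubgroup.isClosed_of_discrete (H := D.logImage D.U))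
  refine Set.Finite.of_finite_image (f := fun u : (𝓞 K)ˣ => fun i : Fin s =>
    Real.log (D.realEmb i ((u : 𝓞 K) : K))) (hfin.subset ?_) ?_
  · rintro _ ⟨u, ⟨hu, hB⟩, rfl⟩
    refine ⟨?_, ?_⟩
    · rw [mem_closedBall_zero_iff]
      have hB0 : 0 ≤ B := (abs_nonneg _).trans (hB ⟨0, D.s_pos⟩)
      exact (pi_norm_le_iff_of_nonneg hB0).mpr hB
    · refine ⟨Additive.ofMul u, hu, ?_⟩
      funext i
      simp [projFirst, EmbeddingNumbering.logMap]
  · rintro u ⟨hu, -⟩ v ⟨hv, -⟩ huv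
    have h := congrFun huv ⟨0, D.s_pos⟩
    have h' := Real.log_injOn_pos (D.admissible.pos u hu _) (D.admissible.pos v hv _) h
    exact Units.ext (NumberField.RingOfIntegers.ext ((D.realEmb _).injective h'))

/-- The action is properly discontinuous. -/
instance properlyDiscontinuousSMul (D : OTData K s t) :
    ProperlyDiscontinuousSMul D.Gamma (domain s t) where
  finite_disjoint_inter_image {A L} hA hL := by
    -- bounds on compact sets
    have key : ∀ A : Set (domain s t), IsCompact A → ∃ B : ℝ, 0 ≤ B ∧ ∀ z ∈ A,
        (∀ k, ‖(z : Fin s ⊕ Fin t → ℂ) k‖ ≤ B) ∧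
        ∀ i, |Real.log ((z : Fin s ⊕ Fin t → ℂ) (Sum.inl i)).im| ≤ B := by
      intro A hA
      have h1 : ContinuousOn (fun z : domain s t => (z : Fin s ⊕ Fin t → ℂ)) A :=
        continuous_subtype_val.continuousOn
      have h2 : ContinuousOn (fun z : domain s t => fun i : Fin s =>
          Real.log ((z : Fin s ⊕ Fin t → ℂ) (Sum.inl i)).im) A := by
        refine (continuous_pi fun i => ?_).continuousOn
        exact Continuous.log (Complex.continuous_im.comp
          ((continuous_apply _).comp continuous_subtype_val)) fun z => (z.2 i).ne'
      obtain ⟨B₁, hB₁⟩ := hA.exists_bound_of_continuousOn h1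
      obtain ⟨B₂, hB₂⟩ := hA.exists_bound_of_continuousOn h2
      refine ⟨max 0 (max B₁ B₂), le_max_left _ _, fun z hz => ⟨fun k => ?_, fun i => ?_⟩⟩
      · exact ((norm_le_pi_norm _ k).trans (hB₁ z hz)).trans
          ((le_max_left _ _).trans (le_max_right _ _))
      · exact ((norm_le_pi_norm (fun i : Fin s =>
          Real.log ((z : Fin s ⊕ Fin t → ℂ) (Sum.inl i)).im) i).trans (hB₂ z hz)).trans
          ((le_max_right _ _).trans (le_max_right _ _))
    obtain ⟨B₁, hB₁0, hB₁⟩ := key A hA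
    obtain ⟨B₂, hB₂0, hB₂⟩ := key L hL
    let S : Set (𝓞 K)ˣ :=
      {u | u ∈ D.U ∧ ∀ i, |Real.log (D.realEmb i ((u : 𝓞 K) : K))| ≤ B₁ + B₂}
    have hS : S.Finite := D.finite_unitPart _
    -- a bound for all the embeddings of the finitely many units in `S`
    have hS' : (Set.range fun p : S × (Fin s ⊕ Fin t) =>
        ‖D.emb p.2 (((p.1 : (𝓞 K)ˣ) : 𝓞 K) : K)‖).Finite := by
      have := hS.to_subtype
      exact Set.finite_range _
    obtain ⟨C, hC⟩ := hS'.bddAbove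
    have hfin := (hS.prod (finite_transPart D.toEmbeddingNumbering (B₂ + C * B₁)))
    refine Set.Finite.of_finite_image (f := fun γ : D.Gamma =>
      ((γ.right : (𝓞 K)ˣ), D.transPart γ)) (hfin.subset ?_) ?_
    · rintro _ ⟨γ, ⟨_, ⟨z, hz, rfl⟩, hw⟩, rfl⟩
      have hz' := hB₁ z hz
      have hw' := hB₂ _ hw
      simp only [coe_smul] at hw'
      have hu : (γ.right : (𝓞 K)ˣ) ∈ S := by
        refine ⟨γ.right.2, fun i => ?_⟩
        have h1 := hw'.2 i
        rw [affine_inl_im, Real.log_mul (D.unitPart_pos γ i).ne' (z.2 i).ne'] at h1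
        have h2 := hz'.2 i
        change |Real.log (D.realEmb i (D.unitPart γ))| ≤ _
        rw [abs_le] at *
        constructor <;> linarith [h1.1, h1.2, h2.1, h2.2]
      refine ⟨hu, (NumberField.RingOfIntegers.isIntegral_coe _), fun k => ?_⟩
      have h3 : D.emb k (D.transPart γ)
          = D.affine γ z k - D.emb k (D.unitPart γ) * (z : Fin s ⊕ Fin t → ℂ) k := by
        simp [affine]
      have h4 : ‖D.emb k (D.unitPart γ)‖ ≤ C := hC ⟨(⟨_, hu⟩, k), rfl⟩
      have h5 : 0 ≤ C := (norm_nonneg _).trans h4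
      rw [h3]
      refine (norm_sub_le _ _).trans (add_le_add (hw'.1 k) ?_)
      rw [norm_mul]
      exact mul_le_mul h4 (hz'.1 k) (norm_nonneg _) h5
    · rintro γ - δ - h
      rw [Prod.mk.injEq] at h
      exact D.gamma_ext (congrArg (fun u : (𝓞 K)ˣ => ((u : 𝓞 K) : K)) h.1) h.2

instance locallyCompactSpace_domain : LocallyCompactSpace (domain s t) :=
  (domain s t).isOpen.locallyCompactSpace

/-- The Oeljeklaus–Toma manifold `M = (ℍ^s × ℂ^t) / (U ⋉ O_K)`. -/
abbrev Manifold (D : OTData K s t) : Type := MulAction.orbitRel.Quotient D.Gamma (domain s t)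

/-- The projection `ℍ^s × ℂ^t → M`. -/
def proj (D : OTData K s t) : domain s t → D.Manifold := Quotient.mk _

lemma isLocalHomeomorph_proj (D : OTData K s t) : IsLocalHomeomorph D.proj :=
  isQuotientCoveringMap_quotientMk_of_properlyDiscontinuousSMul.isCoveringMap.isLocalHomeomorph

lemma proj_eq_iff (D : OTData K s t) {z w : domain s t} :
    D.proj z = D.proj w ↔ ∃ γ : D.Gamma, γ • w = z :=
  Quotient.eq''

/-- The charts of `M` are the local inverses of the projection. -/
lemma exists_of_mem_atlas (D : OTData K s t)
    {e : OpenPartialHomeomorph D.Manifold (Fin s ⊕ Fin t → ℂ)}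
    (he : e ∈ atlas (Fin s ⊕ Fin t → ℂ) D.Manifold) :
    ∃ z : domain s t, e = (D.isLocalHomeomorph_proj.localInverseAt z).trans
      (chartAt (Fin s ⊕ Fin t → ℂ) z) := by
  obtain ⟨q, rfl⟩ := he
  exact ⟨_, rfl⟩

lemma proj_of_mem_target (D : OTData K s t)
    {e : OpenPartialHomeomorph D.Manifold (Fin s ⊕ Fin t → ℂ)}
    (he : e ∈ atlas (Fin s ⊕ Fin t → ℂ) D.Manifold) {p : D.Manifold} (hp : p ∈ e.source) :
    ∃ w : domain s t, (w : Fin s ⊕ Fin t → ℂ) = e p ∧ D.proj w = p := by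
  obtain ⟨z, rfl⟩ := D.exists_of_mem_atlas he
  refine ⟨D.isLocalHomeomorph_proj.localInverseAt z p, rfl, ?_⟩
  exact D.isLocalHomeomorph_proj.apply_localInverseAt_of_mem hp.1

/-- `M` is a complex manifold. -/
instance isManifold (D : OTData K s t) :
    IsManifold 𝓘(ℂ, Fin s ⊕ Fin t → ℂ) ω D.Manifold := by
  refine isManifold_of_contDiffOn _ _ _ fun e e' he he' => ?_
  simp only [modelWithCornersSelf_coe, modelWithCornersSelf_coe_symm, Set.range_id,
    Set.inter_univ, Set.preimage_id, Function.id_comp, Function.comp_id]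
  intro y hy
  have hy1 : y ∈ e.target := hy.1
  have hy2 : e.symm y ∈ e'.source := hy.2
  obtain ⟨w, hw, hwp⟩ := D.proj_of_mem_target he (e.map_target hy1)
  obtain ⟨w', hw', hwp'⟩ := D.proj_of_mem_target he' hy2
  obtain ⟨γ, hγ⟩ := D.proj_eq_iff.mp (hwp'.trans hwp.symm)
  rw [e.right_inv hy1] at hw
  have hγy : D.affine γ y = e' (e.symm y) := by
    rw [← hw', ← hγ, coe_smul, hw]
  refine ((D.contDiff_affine γ).contDiffAt.congr_of_eventuallyEq ?_).contDiffWithinAt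
  have hT : D.affine γ y ∈ e'.target := hγy ▸ e'.map_source hy2
  filter_upwards [(e.symm ≫ₕ e').open_source.mem_nhds hy,
    (D.contDiff_affine γ).continuous.continuousAt.preimage_mem_nhds
      (e'.open_target.mem_nhds hT)] with x hx hx'
  obtain ⟨v, hv, hvp⟩ := D.proj_of_mem_target he (e.map_target hx.1)
  rw [e.right_inv hx.1] at hv
  obtain ⟨v', hv', hvp'⟩ := D.proj_of_mem_target he' (e'.map_target hx')
  rw [e'.right_inv hx'] at hv'
  have h1 : v' = γ • v := Subtype.ext (by rw [hv', coe_smul, hv])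
  have h2 : e'.symm (D.affine γ x) = e.symm x := by
    rw [← hvp', ← hvp]
    exact D.proj_eq_iff.mpr ⟨γ, h1.symm⟩
  change e' (e.symm x) = _
  rw [← h2, e'.right_inv hx']

end OTData

/-- `C` is a complex submanifold of dimension `d` of the complex manifold `M`: around each of its
points there is a holomorphic chart of `M` in which `C` is a linear subspace of dimension `d`. -/
def IsComplexSubmanifold {E : Type*} [NormedAddCommGroup E] [NormedSpace ℂ E] {M : Type*}
    [TopologicalSpace M] [ChartedSpace E M] (d : ℕ) (C : Set M) : Prop :=
  ∀ p ∈ C, ∃ e ∈ IsManifold.maximalAtlas 𝓘(ℂ, E) ω M, p ∈ e.source ∧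
    ∃ W : Submodule ℂ E, Module.finrank ℂ W = d ∧ ∀ q ∈ e.source, q ∈ C ↔ e q ∈ W

end OeljeklausToma

end

noncomputable section

namespace OeljeklausToma

open Set Filter Topology MeasureTheory

/-! Let `f` be a holomorphic map from a compact Riemann surface `X` to `M`. A component `w` of a
local lift of `f` in an `ℍ`-direction is determined up to `w ↦ σ w + α` with `σ`, `α` real and `σ >
0`, so the form `dw / Im w` does not depend on the lift and is a global `(1,0)`-form on `X`. Its
coefficient `g = w' / Im w` satisfies `dbar g = -i |g|²` (`dbar_logForm`). By Stokes
(`sum_setIntegral_dbar_eq_zero`) the integral of `∂̄` of a global `(1,0)`-form over `X` is zero; as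
`|g|² ≥ 0`, this forces `g = 0`, so `w` is locally constant (`eventually_eq_of_affine_branches`).

Hence `f` stays locally in the image of a leaf `{z} × ℂ^t`. An element of `U ⋉ O_K` fixing one
coordinate in `ℍ` is trivial, so leaves inject into `M` (`eq_of_proj_eq_of_inl_eq`). Lifting `f` to
a leaf gives a holomorphic vector-valued function on the compact `X`, which is locally constant by
the maximum principle; so `f` is locally constant (`isLocallyConstant_of_mdifferentiable`).

A compact one-dimensional submanifold is itself a compact Riemann surface with holomorphic
inclusion, and this inclusion is not locally constant. -/

/-! ### The operator `∂̄` in the plane and its integrals -/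

/-- Twice the Wirtinger derivative `∂/∂z̄`. -/
def dbar (h : ℂ → ℂ) (c : ℂ) : ℂ := fderiv ℝ h c 1 + Complex.I * fderiv ℝ h c Complex.I

lemma dbar_mul {r h : ℂ → ℂ} {c : ℂ} (hr : DifferentiableAt ℝ r c) (hh : DifferentiableAt ℝ h c) :
    dbar (fun z => r z * h z) c = dbar r c * h c + r c * dbar h c := by
  simp only [dbar, fderiv_fun_mul hr hh, add_apply, smul_apply, smul_eq_mul]
  ring

/-- The real differential of `τ` is multiplication by `τ'`, and the conjugate-linear part of a
differential composed with it acquires the factor `conj τ'`. This is the transformation rule for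
coefficients of `(0,1)`-forms. -/
lemma dbar_comp {r τ : ℂ → ℂ} {τ' c : ℂ} (hr : DifferentiableAt ℝ r (τ c))
    (hτ : HasDerivAt τ τ' c) :
    dbar (fun z => r (τ z)) c = (starRingEnd ℂ) τ' * dbar r (τ c) := by
  have hτ' : HasFDerivAt τ ((ContinuousLinearMap.toSpanSingleton ℂ τ').restrictScalars ℝ) c :=
    hτ.hasFDerivAt.restrictScalars ℝ
  have h := (hr.hasFDerivAt.comp c hτ').fderiv
  have key : ∀ v : ℂ, fderiv ℝ r (τ c) v
      = v.re * fderiv ℝ r (τ c) 1 + v.im * fderiv ℝ r (τ c) Complex.I := by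
    intro v
    conv_lhs => rw [show v = v.re • (1 : ℂ) + v.im • Complex.I by simp [Complex.re_add_im]]
    rw [map_add, map_smul, map_smul, Complex.real_smul, Complex.real_smul]
  change fderiv ℝ (r ∘ τ) c 1 + Complex.I * fderiv ℝ (r ∘ τ) c Complex.I = _
  rw [h]
  simp only [ContinuousLinearMap.comp_apply, ContinuousLinearMap.coe_restrictScalars',
    ContinuousLinearMap.toSpanSingleton_apply, smul_eq_mul, one_mul, dbar]
  have hconj : (starRingEnd ℂ) τ' = τ'.re - τ'.im * Complex.I := by
    apply Complex.ext <;> simp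
  rw [key τ', key (Complex.I * τ'), hconj]
  simp only [Complex.mul_re, Complex.mul_im, Complex.I_re, Complex.I_im]
  push_cast
  linear_combination (τ'.im * fderiv ℝ r (τ c) Complex.I) * Complex.I_sq

lemma dbar_congr {h k : ℂ → ℂ} {c : ℂ} (e : h =ᶠ[𝓝 c] k) : dbar h c = dbar k c := by
  simp only [dbar, e.fderiv_eq]

lemma dbar_zero_of_eventuallyEq {h : ℂ → ℂ} {c : ℂ} (e : ∀ᶠ z in 𝓝 c, h z = 0) :
    dbar h c = 0 := by
  rw [dbar_congr (k := fun _ => 0) e]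
  simp [dbar]

lemma dbar_sum {ι : Type*} (u : Finset ι) {h : ι → ℂ → ℂ} {c : ℂ}
    (hh : ∀ i ∈ u, DifferentiableAt ℝ (h i) c) :
    dbar (fun z => ∑ i ∈ u, h i z) c = ∑ i ∈ u, dbar (h i) c := by
  simp only [dbar, fderiv_fun_sum hh, sum_apply, Finset.sum_add_distrib, Finset.mul_sum]

lemma continuousOn_dbar {h : ℂ → ℂ} {T : Set ℂ} (hT : IsOpen T) (hh : ContDiffOn ℝ 1 h T) :
    ContinuousOn (dbar h) T := by
  have := hh.continuousOn_fderiv_of_isOpen hT le_rfl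
  unfold dbar
  fun_prop

lemma integral_fderiv_apply_eq_zero {F : ℂ → ℂ} (hF : ContDiff ℝ 1 F) (hc : HasCompactSupport F)
    (v : ℂ) : Integrable (fun x => fderiv ℝ F x v) ∧ ∫ x, fderiv ℝ F x v = 0 := by
  have hi : Integrable (fun x => fderiv ℝ F x v) := by
    refine Continuous.integrable_of_hasCompactSupport ?_ ?_
    · exact (hF.continuous_fderiv one_ne_zero).clm_apply continuous_const
    · exact hc.fderiv_apply ℝ v
  refine ⟨hi, ?_⟩
  -- Integration by parts against the constant function `1`.
  have := integral_mul_fderiv_eq_neg_fderiv_mul_of_integrable (μ := volume)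
    (f := fun _ : ℂ => (1 : ℂ)) (g := F) (v := v) (by simp) (by simpa using hi)
    (by simpa using hF.continuous.integrable_of_hasCompactSupport hc) (by simp)
    (fun x _ => hF.differentiable one_ne_zero x)
  simpa using this

lemma integral_dbar_eq_zero {F : ℂ → ℂ} (hF : ContDiff ℝ 1 F) (hc : HasCompactSupport F) :
    ∫ x, dbar F x = 0 := by
  obtain ⟨h1, h1'⟩ := integral_fderiv_apply_eq_zero hF hc 1
  obtain ⟨h2, h2'⟩ := integral_fderiv_apply_eq_zero hF hc Complex.I
  unfold dbar
  rw [integral_add h1 (h2.const_mul _), integral_const_mul, h1', h2']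
  simp

/-- The integral of `∂̄k` vanishes if `k` is zero off a compact subset of its open domain `T`. -/
lemma setIntegral_dbar_eq_zero {k : ℂ → ℂ} {T Q : Set ℂ} (hT : IsOpen T) (hQ : IsCompact Q)
    (hQT : Q ⊆ T) (hk : ContDiffOn ℝ 1 k T) (h0 : ∀ c ∈ T, c ∉ Q → k c = 0) :
    ∫ c in T, dbar k c = 0 := by
  have hoff : ∀ c ∉ Q, T.indicator k c = 0 := fun c hc => by
    by_cases hcT : c ∈ T
    · simp [hcT, h0 c hcT hc]
    · simp [hcT]
  have hon : ∀ c ∈ T, T.indicator k =ᶠ[𝓝 c] k := fun c hc => by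
    filter_upwards [hT.mem_nhds hc] with z hz
    simp [hz]
  have hnear : ∀ c ∉ Q, T.indicator k =ᶠ[𝓝 c] fun _ => 0 := fun c hc => by
    filter_upwards [hQ.isClosed.isOpen_compl.mem_nhds hc] with z hz
    exact hoff z hz
  -- The extension of `k` by zero is `C¹` on all of `ℂ`: the open sets `T` and the complement of `Q`
  -- cover the plane, and it is zero on the latter.
  have hF : ContDiff ℝ 1 (T.indicator k) := by
    rw [contDiff_iff_contDiffAt]
    intro c
    by_cases hc : c ∈ Q
    · exact (hk.contDiffAt (hT.mem_nhds (hQT hc))).congr_of_eventuallyEq (hon c (hQT hc))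
    · exact contDiffAt_const.congr_of_eventuallyEq (hnear c hc)
  have hz := integral_dbar_eq_zero hF (HasCompactSupport.intro hQ hoff)
  rw [← setIntegral_eq_integral_of_forall_compl_eq_zero (s := T)] at hz
  · rw [← hz]
    exact setIntegral_congr_fun hT.measurableSet fun c hc => (dbar_congr (hon c hc)).symm
  · exact fun c hc => dbar_zero_of_eventuallyEq (hnear c fun h => hc (hQT h))

lemma integrableOn_of_eq_zero_off_compact {k : ℂ → ℂ} {T Q : Set ℂ} (hT : IsOpen T)
    (hQ : IsCompact Q) (hQT : Q ⊆ T) (hk : ContinuousOn k T) (h0 : ∀ c ∈ T, c ∉ Q → k c = 0) :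
    IntegrableOn k T :=
  ((hk.mono hQT).integrableOn_compact hQ).of_forall_sdiff_eq_zero hT.measurableSet
    fun c hc => h0 c hc.1 hc.2

/-! ### Change of charts -/

/-- The real determinant of multiplication by `a` is the norm of `a` from `ℂ` to `ℝ`. It supplies
the Jacobian of a holomorphic change of charts. -/
lemma det_restrictScalars_toSpanSingleton (a : ℂ) :
    ((ContinuousLinearMap.toSpanSingleton ℂ a).restrictScalars ℝ).det = ‖a‖ ^ 2 := by
  rw [← Complex.normSq_eq_norm_sq, ← Algebra.norm_complex_apply, Algebra.norm_apply]
  unfold ContinuousLinearMap.det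
  congr 1
  ext
  simp [mul_comm]

/-- Change of variables between two charts of a Riemann surface. -/
lemma setIntegral_target_eq {X : Type*} [TopologicalSpace X] (e e' : OpenPartialHomeomorph X ℂ)
    (hd : ∀ c ∈ (e.symm ≫ₕ e').source, DifferentiableAt ℂ (fun z => e' (e.symm z)) c)
    (k k' : ℂ → ℂ)
    (hk : ∀ c ∈ (e.symm ≫ₕ e').source,
      k c = (‖deriv (fun z => e' (e.symm z)) c‖ ^ 2 : ℝ) * k' (e' (e.symm c)))
    (h0 : ∀ p ∈ e.source, p ∉ e'.source → k (e p) = 0)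
    (h0' : ∀ p ∈ e'.source, p ∉ e.source → k' (e' p) = 0) :
    ∫ c in e.target, k c = ∫ c in e'.target, k' c := by
  set f := e.symm ≫ₕ e' with hf
  have hcv := integral_target_eq_integral_abs_det_fderiv_smul volume (f := f)
    (f' := fun c => (ContinuousLinearMap.toSpanSingleton ℂ
      (deriv (fun z => e' (e.symm z)) c)).restrictScalars ℝ)
    (fun c hc => (hd c hc).hasDerivAt.hasFDerivAt.restrictScalars ℝ) k'
  have h1 : ∫ c in f.source, k c = ∫ c in e.target, k c := by
    refine Eq.symm <| setIntegral_eq_of_subset_of_forall_sdiff_eq_zero e.open_target.measurableSet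
      (fun c hc => hc.1) ?_
    rintro c ⟨hc, hc'⟩
    rw [← e.right_inv hc]
    refine h0 _ (e.map_target hc) fun h => hc' ⟨hc, h⟩
  have h2 : ∫ c in f.target, k' c = ∫ c in e'.target, k' c := by
    refine Eq.symm <| setIntegral_eq_of_subset_of_forall_sdiff_eq_zero e'.open_target.measurableSet
      (fun c hc => hc.1) ?_
    rintro c ⟨hc, hc'⟩
    rw [← e'.right_inv hc]
    refine h0' _ (e'.map_target hc) fun h => hc' ⟨hc, ?_⟩
    simpa using h
  rw [← h1, ← h2, hcv]
  refine setIntegral_congr_fun f.open_source.measurableSet fun c hc => ?_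
  simp only [det_restrictScalars_toSpanSingleton]
  rw [hk c hc, abs_of_nonneg (by positivity), Complex.real_smul]
  rfl

lemma contDiffOn_transition {E M : Type*} [NormedAddCommGroup E] [NormedSpace ℂ E]
    [TopologicalSpace M] [ChartedSpace E M] [IsManifold 𝓘(ℂ, E) ω M]
    {e e' : OpenPartialHomeomorph M E} (he : e ∈ IsManifold.maximalAtlas 𝓘(ℂ, E) ω M)
    (he' : e' ∈ IsManifold.maximalAtlas 𝓘(ℂ, E) ω M) :
    ContDiffOn ℂ ω (fun z => e' (e.symm z)) (e.symm ≫ₕ e').source := by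
  have h := IsManifold.compatible_of_mem_maximalAtlas he he'
  rw [contDiffGroupoid, mem_groupoid_of_pregroupoid] at h
  have h1 := h.1
  simp only [contDiffPregroupoid, modelWithCornersSelf_coe, modelWithCornersSelf_coe_symm,
    Set.range_id, Set.inter_univ, Set.preimage_id, Function.id_comp, Function.comp_id] at h1
  exact h1

/-! ### Stokes' theorem on a compact Riemann surface -/

section RiemannSurface

variable {X : Type*} [TopologicalSpace X] [ChartedSpace ℂ X]

/-- Smooth partitions of unity live on the underlying real surface. -/
lemma isManifold_real [IsManifold 𝓘(ℂ, ℂ) ω X] : IsManifold 𝓘(ℝ, ℂ) ∞ X := by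
  refine isManifold_of_contDiffOn _ _ _ fun e e' he he' => ?_
  simp only [modelWithCornersSelf_coe, modelWithCornersSelf_coe_symm, Set.range_id,
    Set.inter_univ, Set.preimage_id, Function.id_comp, Function.comp_id]
  exact ((contDiffOn_transition (IsManifold.subset_maximalAtlas he)
    (IsManifold.subset_maximalAtlas he')).restrict_scalars ℝ).of_le le_top

lemma contDiffOn_comp_chart_symm [IsManifold 𝓘(ℝ, ℂ) ∞ X] {ρ : X → ℝ}
    (hρ : ContMDiff 𝓘(ℝ, ℂ) 𝓘(ℝ, ℝ) ∞ ρ) (a : X) :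
    ContDiffOn ℝ 1 (fun c => (ρ ((chartAt ℂ a).symm c) : ℂ)) (chartAt ℂ a).target := by
  have h : ContMDiffOn 𝓘(ℝ, ℂ) 𝓘(ℝ, ℝ) ∞ (ρ ∘ (chartAt ℂ a).symm) (chartAt ℂ a).target :=
    hρ.comp_contMDiffOn (contMDiffOn_chart_symm (I := 𝓘(ℝ, ℂ)) (x := a))
  exact Complex.ofRealCLM.contDiff.comp_contDiffOn
    ((contMDiffOn_iff_contDiffOn.mp h).of_le (m := 1) (by norm_num))

/-- Stokes theorem on a compact Riemann surface: the integral of `∂̄` of a global `(1,0)`-form,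
given by its coefficients `G a` in the charts, vanishes. -/
theorem sum_setIntegral_dbar_eq_zero [CompactSpace X] [IsManifold 𝓘(ℂ, ℂ) ω X]
    (G : X → ℂ → ℂ) (hG : ∀ a, ContDiffOn ℝ 1 (G a) (chartAt ℂ a).target)
    (hGt : ∀ a b, ∀ c ∈ ((chartAt ℂ a).symm ≫ₕ chartAt ℂ b).source,
      G a c = G b (chartAt ℂ b ((chartAt ℂ a).symm c)) *
        deriv (fun z => chartAt ℂ b ((chartAt ℂ a).symm z)) c)
    (u : Finset X) (ρ : X → X → ℝ) (hρ : ∀ a, ContMDiff 𝓘(ℝ, ℂ) 𝓘(ℝ, ℝ) ∞ (ρ a))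
    (hsupp : ∀ a, tsupport (ρ a) ⊆ (chartAt ℂ a).source) (hsum : ∀ p, ∑ a ∈ u, ρ a p = 1) :
    ∑ a ∈ u, ∫ c in (chartAt ℂ a).target,
      (ρ a ((chartAt ℂ a).symm c) : ℂ) * dbar (G a) c = 0 := by
  have : IsManifold 𝓘(ℝ, ℂ) ∞ X := isManifold_real
  -- `r a b` is the function `ρ a` in the chart at `b`
  let r : X → X → ℂ → ℂ := fun a b c => (ρ a ((chartAt ℂ b).symm c) : ℂ)
  let T : X → Set ℂ := fun a => (chartAt ℂ a).target
  have hT : ∀ a, IsOpen (T a) := fun a => (chartAt ℂ a).open_target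
  have hr : ∀ a b, ContDiffOn ℝ 1 (r a b) (T b) := fun a b => contDiffOn_comp_chart_symm (hρ a) b
  have hrd : ∀ a b, ∀ c ∈ T b, DifferentiableAt ℝ (r a b) c := fun a b c hc =>
    ((hr a b).contDiffAt ((hT b).mem_nhds hc)).differentiableAt one_ne_zero
  have hGd : ∀ a, ∀ c ∈ T a, DifferentiableAt ℝ (G a) c := fun a c hc =>
    ((hG a).contDiffAt ((hT a).mem_nhds hc)).differentiableAt one_ne_zero
  let Q : X → Set ℂ := fun a => chartAt ℂ a '' tsupport (ρ a)
  have hQ : ∀ a, IsCompact (Q a) := fun a =>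
    (isClosed_tsupport (ρ a)).isCompact.image_of_continuousOn
      ((chartAt ℂ a).continuousOn.mono (hsupp a))
  have hQT : ∀ a, Q a ⊆ T a := by
    rintro a _ ⟨p, hp, rfl⟩
    exact (chartAt ℂ a).map_source (hsupp a hp)
  have hnot : ∀ a, ∀ c ∈ T a, c ∉ Q a → (chartAt ℂ a).symm c ∉ tsupport (ρ a) :=
    fun a c hc hcQ h => hcQ ⟨_, h, (chartAt ℂ a).right_inv hc⟩
  have hr0 : ∀ a b, ∀ c ∈ T b, (chartAt ℂ b).symm c ∉ tsupport (ρ a) → r a b c = 0 :=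
    fun a b c hc h => by simp [r, image_eq_zero_of_notMem_tsupport h]
  have hdr0 : ∀ a b, ∀ c ∈ T b, (chartAt ℂ b).symm c ∉ tsupport (ρ a) → dbar (r a b) c = 0 := by
    intro a b c hc h
    refine dbar_zero_of_eventuallyEq ?_
    filter_upwards [((chartAt ℂ b).continuousAt_symm hc).preimage_mem_nhds
      ((isClosed_tsupport (ρ a)).isOpen_compl.mem_nhds h), (hT b).mem_nhds hc] with z hz hz'
    exact hr0 a b z hz' hz
  have hdr : ∀ a b, ContinuousOn (dbar (r a b)) (T b) := fun a b =>
    continuousOn_dbar (hT b) (hr a b)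
  -- integration by parts in each chart
  have hparts : ∀ a, ∫ c in T a, r a a c * dbar (G a) c = - ∫ c in T a, dbar (r a a) c * G a c := by
    intro a
    have h1 : IntegrableOn (fun c => dbar (r a a) c * G a c) (T a) :=
      integrableOn_of_eq_zero_off_compact (hT a) (hQ a) (hQT a)
        ((hdr a a).mul (hG a).continuousOn) fun c hc hcQ => by
          rw [hdr0 a a c hc (hnot a c hc hcQ), zero_mul]
    have h2 : IntegrableOn (fun c => r a a c * dbar (G a) c) (T a) :=
      integrableOn_of_eq_zero_off_compact (hT a) (hQ a) (hQT a)
        ((hr a a).continuousOn.mul (continuousOn_dbar (hT a) (hG a))) fun c hc hcQ => by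
          rw [hr0 a a c hc (hnot a c hc hcQ), zero_mul]
    have h := setIntegral_dbar_eq_zero (hT a) (hQ a) (hQT a) ((hr a a).mul (hG a))
      fun c hc hcQ => by rw [hr0 a a c hc (hnot a c hc hcQ), zero_mul]
    have h3 : ∫ c in T a, dbar (fun x => r a a x * G a x) c
        = ∫ c in T a, (dbar (r a a) c * G a c + r a a c * dbar (G a) c) :=
      setIntegral_congr_fun (hT a).measurableSet fun c hc => dbar_mul (hrd a a c hc) (hGd a c hc)
    rw [h3, integral_add h1 h2] at h
    exact eq_neg_of_add_eq_zero_right h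
  -- insertion of the partition of unity
  have hsum' : ∀ b c, ∑ a ∈ u, r a b c = 1 := fun b c => by
    simp only [r]
    exact_mod_cast hsum _
  have hinsert : ∀ a, ∫ c in T a, dbar (r a a) c * G a c
      = ∑ b ∈ u, ∫ c in T a, r b a c * dbar (r a a) c * G a c := by
    intro a
    rw [← integral_finsetSum]
    · refine setIntegral_congr_fun (hT a).measurableSet fun c hc => ?_
      change _ = ∑ b ∈ u, r b a c * dbar (r a a) c * G a c
      rw [← Finset.sum_mul, ← Finset.sum_mul, hsum', one_mul]
    · intro b _
      refine integrableOn_of_eq_zero_off_compact (hT a) (hQ a) (hQT a)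
        (((hr b a).continuousOn.mul (hdr a a)).mul (hG a).continuousOn) fun c hc hcQ => ?_
      rw [hdr0 a a c hc (hnot a c hc hcQ), mul_zero, zero_mul]
  -- passage to the chart at `b`
  have hchange : ∀ a b, ∫ c in T a, r b a c * dbar (r a a) c * G a c
      = ∫ c in T b, r b b c * dbar (r a b) c * G b c := by
    intro a b
    have hτ : ∀ c ∈ ((chartAt ℂ a).symm ≫ₕ chartAt ℂ b).source,
        DifferentiableAt ℂ (fun z => chartAt ℂ b ((chartAt ℂ a).symm z)) c := fun c hc =>
      ((contDiffOn_transition (IsManifold.chart_mem_maximalAtlas a)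
        (IsManifold.chart_mem_maximalAtlas b)).contDiffAt
        (((chartAt ℂ a).symm ≫ₕ chartAt ℂ b).open_source.mem_nhds hc)).differentiableAt (by simp)
    refine setIntegral_target_eq (chartAt ℂ a) (chartAt ℂ b) hτ _ _ ?_ ?_ ?_
    · intro c hc
      have hcb : chartAt ℂ b ((chartAt ℂ a).symm c) ∈ T b := (chartAt ℂ b).map_source hc.2
      have hrr : ∀ d, ∀ z ∈ ((chartAt ℂ a).symm ≫ₕ chartAt ℂ b).source,
          r d a z = r d b (chartAt ℂ b ((chartAt ℂ a).symm z)) := fun d z hz => by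
        have hz2 : (chartAt ℂ a).symm z ∈ (chartAt ℂ b).source := hz.2
        change (ρ d _ : ℂ) = ρ d _
        rw [(chartAt ℂ b).left_inv hz2]
      have h1 : dbar (r a a) c = (starRingEnd ℂ)
          (deriv (fun z => chartAt ℂ b ((chartAt ℂ a).symm z)) c) *
            dbar (r a b) (chartAt ℂ b ((chartAt ℂ a).symm c)) := by
        rw [← dbar_comp (hrd a b _ hcb) (hτ c hc).hasDerivAt]
        refine dbar_congr ?_
        filter_upwards [((chartAt ℂ a).symm ≫ₕ chartAt ℂ b).open_source.mem_nhds hc] with z hz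
        exact hrr a z hz
      -- The factor `conj τ'` from `∂̄ρ` and the factor `τ'` from `G` multiply to `|τ'|²`, the
      -- Jacobian in the change of variables.
      rw [hrr b c hc, h1, hGt a b c hc, ← Complex.normSq_eq_norm_sq, ← Complex.mul_conj]
      ring
    · intro p hp hpb
      have hp' : p ∉ tsupport (ρ b) := fun h => hpb (hsupp b h)
      rw [hr0 b a _ ((chartAt ℂ a).map_source hp) (by rwa [(chartAt ℂ a).left_inv hp])]
      ring
    · intro p hp hpa
      have hp' : p ∉ tsupport (ρ a) := fun h => hpa (hsupp a h)
      rw [hdr0 a b _ ((chartAt ℂ b).map_source hp) (by rwa [(chartAt ℂ b).left_inv hp])]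
      ring
  -- For fixed `b` the sum over `a` produces `∂̄` of `∑ ρ a = 1`, which is zero.
  have hfinal : ∀ b, ∑ a ∈ u, ∫ c in T b, r b b c * dbar (r a b) c * G b c = 0 := by
    intro b
    rw [← integral_finsetSum]
    · refine setIntegral_eq_zero_of_forall_eq_zero fun c hc => ?_
      rw [← Finset.sum_mul, ← Finset.mul_sum, ← dbar_sum u fun a _ => hrd a b c hc]
      simp only [hsum']
      simp [dbar]
    · intro a _
      refine integrableOn_of_eq_zero_off_compact (hT b) (hQ b) (hQT b)
        (((hr b b).continuousOn.mul (hdr a b)).mul (hG b).continuousOn) fun c hc hcQ => ?_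
      rw [hr0 b b c hc (hnot b c hc hcQ), zero_mul, zero_mul]
  calc ∑ a ∈ u, ∫ c in T a, r a a c * dbar (G a) c
      = - ∑ a ∈ u, ∑ b ∈ u, ∫ c in T b, r b b c * dbar (r a b) c * G b c := by
        rw [← Finset.sum_neg_distrib]
        refine Finset.sum_congr rfl fun a _ => ?_
        rw [hparts, hinsert]
        exact congrArg _ (Finset.sum_congr rfl fun b _ => hchange a b)
    _ = 0 := by
        rw [Finset.sum_comm]
        simp [hfinal]

end RiemannSurface

/-! ### The form `dW / Im W` -/

/-- The chain rule with outer function `id`, for which `dbar id = 1 + i² = 0`. -/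
lemma dbar_eq_zero_of_differentiableAt {h : ℂ → ℂ} {c : ℂ} (hh : DifferentiableAt ℂ h c) :
    dbar h c = 0 := by
  have := dbar_comp (r := id) (τ := h) differentiableAt_id hh.hasDerivAt
  simp only [id] at this
  rw [this]
  simp [dbar]

lemma dbar_ofReal_im {W : ℂ → ℂ} {c : ℂ} (hW : DifferentiableAt ℂ W c) :
    dbar (fun z => ((W z).im : ℂ)) c = Complex.I * (starRingEnd ℂ) (deriv W c) := by
  let r : ℂ →L[ℝ] ℂ := Complex.ofRealCLM.comp Complex.imCLM
  have h := dbar_comp (r := r) (τ := W) r.differentiableAt hW.hasDerivAt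
  have hr : dbar r (W c) = Complex.I := by
    simp [dbar, r.fderiv, r]
  rw [hr, mul_comm] at h
  exact h

/-- The coefficient `W'/Im W` of the `(1,0)`-form `dW/Im W`. -/
def logForm (W : ℂ → ℂ) (c : ℂ) : ℂ := deriv W c / ((W c).im : ℂ)

lemma contDiffAt_logForm {W : ℂ → ℂ} {c : ℂ} (hW : AnalyticAt ℂ W c) (him : (W c).im ≠ 0) :
    ContDiffAt ℝ 1 (logForm W) c := by
  have h1 : ContDiffAt ℝ 1 (deriv W) c := hW.deriv.contDiffAt.restrict_scalars ℝ
  have h2 : ContDiffAt ℝ 1 W c := hW.contDiffAt.restrict_scalars ℝ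
  have h3 : ContDiffAt ℝ 1 (fun z => ((W z).im : ℂ)) c :=
    (Complex.ofRealCLM.comp Complex.imCLM).contDiff.contDiffAt.comp c h2
  have h4 := h1.mul (h3.inv (by exact_mod_cast him))
  have h5 : logForm W = fun z => deriv W z * ((W z).im : ℂ)⁻¹ :=
    funext fun z => div_eq_mul_inv _ _
  rw [h5]
  exact h4

/-- Since `logForm W * Im W = W'` is holomorphic, Leibniz gives `dbar (logForm W) * Im W = -logForm
W * dbar (Im W)`, and `dbar (Im W) = i conj W'`. The result is `-i` times a nonnegative real number,
the sign on which the whole argument rests. -/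
lemma dbar_logForm {W : ℂ → ℂ} {c : ℂ} (hW : AnalyticAt ℂ W c) (him : (W c).im ≠ 0) :
    dbar (logForm W) c = -Complex.I * (‖logForm W c‖ ^ 2 : ℝ) := by
  have him' : ((W c).im : ℂ) ≠ 0 := by exact_mod_cast him
  have hv : DifferentiableAt ℝ (fun z => ((W z).im : ℂ)) c :=
    (Complex.ofRealCLM.comp Complex.imCLM).differentiableAt.comp c
      (hW.differentiableAt.restrictScalars ℝ)
  have hmul := dbar_mul ((contDiffAt_logForm hW him).differentiableAt one_ne_zero) hv
  have hnear : (fun z => logForm W z * ((W z).im : ℂ)) =ᶠ[𝓝 c] deriv W := by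
    have hcont : ContinuousAt (fun z => (W z).im) c :=
      Complex.continuous_im.continuousAt.comp hW.continuousAt
    filter_upwards [hcont.eventually_ne him] with z hz
    exact div_mul_cancel₀ _ (by exact_mod_cast hz)
  rw [dbar_congr hnear, dbar_eq_zero_of_differentiableAt hW.deriv.differentiableAt,
    dbar_ofReal_im hW.differentiableAt] at hmul
  have hconj : (starRingEnd ℂ) (deriv W c) = (starRingEnd ℂ) (logForm W c) * ((W c).im : ℂ) := by
    rw [← Complex.conj_ofReal (W c).im, ← map_mul]
    congr 1
    exact (div_mul_cancel₀ _ him').symm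
  rw [hconj] at hmul
  rw [← Complex.normSq_eq_norm_sq, ← Complex.mul_conj]
  apply mul_right_cancel₀ him'
  linear_combination -hmul

lemma eventually_const_of_eventually_deriv_eq_zero {W : ℂ → ℂ} {c : ℂ}
    (hd : ∀ᶠ z in 𝓝 c, DifferentiableAt ℂ W z) (h0 : ∀ᶠ z in 𝓝 c, deriv W z = 0) :
    ∀ᶠ z in 𝓝 c, W z = W c := by
  obtain ⟨ε, hε, hball⟩ := Metric.eventually_nhds_iff_ball.mp (hd.and h0)
  filter_upwards [Metric.ball_mem_nhds c hε] with z hz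
  exact Metric.isOpen_ball.is_const_of_deriv_eq_zero (convex_ball c ε).isPreconnected
    (fun y hy => (hball y hy).1.differentiableWithinAt) (fun y hy => (hball y hy).2) hz
    (Metric.mem_ball_self hε)

/-! ### Multivalued functions with values in the upper half-plane -/

section RiemannSurface

variable {X : Type*} [TopologicalSpace X] [ChartedSpace ℂ X]

lemma eventually_comp_chart_symm {P : X → Prop} {a : X} {c : ℂ} (hc : c ∈ (chartAt ℂ a).target)
    (h : ∀ᶠ y in 𝓝 ((chartAt ℂ a).symm c), P y) : ∀ᶠ z in 𝓝 c, P ((chartAt ℂ a).symm z) :=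
  ((chartAt ℂ a).continuousAt_symm hc).eventually h

variable [IsManifold 𝓘(ℂ, ℂ) ω X]

lemma differentiableAt_comp_chart_symm {F : Type*} [NormedAddCommGroup F] [NormedSpace ℂ F]
    {g : X → F} {a : X} {c : ℂ} (hc : c ∈ (chartAt ℂ a).target)
    (hg : MDifferentiableAt 𝓘(ℂ, ℂ) 𝓘(ℂ, F) g ((chartAt ℂ a).symm c)) :
    DifferentiableAt ℂ (fun z => g ((chartAt ℂ a).symm z)) c := by
  have : IsManifold 𝓘(ℂ, ℂ) 1 X := IsManifold.of_le (n := ω) le_top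
  rw [← mdifferentiableAt_iff_differentiableAt]
  exact hg.comp c (mdifferentiableAt_atlas_symm (chart_mem_atlas ℂ a) hc)

/-- On a compact Riemann surface, a multivalued holomorphic function with values in the upper half
plane whose branches differ by real affine transformations is locally constant. -/
theorem eventually_eq_of_affine_branches [T2Space X] [CompactSpace X] (w : X → X → ℂ)
    (hd : ∀ x, ∀ᶠ y in 𝓝 x, MDifferentiableAt 𝓘(ℂ, ℂ) 𝓘(ℂ, ℂ) (w x) y)
    (him : ∀ x, ∀ᶠ y in 𝓝 x, 0 < (w x y).im)
    (haff : ∀ x, ∀ᶠ y in 𝓝 x, ∃ σ α : ℝ, σ ≠ 0 ∧ ∀ᶠ y' in 𝓝 y, w x y' = σ * w y y' + α) (x : X) :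
    ∀ᶠ y in 𝓝 x, w x y = w x x := by
  -- At each point the coefficient is computed from the branch based at that very point, so no
  -- coherent choice of branches is needed.
  let G : X → ℂ → ℂ := fun a c =>
    logForm (fun z => w ((chartAt ℂ a).symm c) ((chartAt ℂ a).symm z)) c
  have hWd : ∀ a, ∀ c ∈ (chartAt ℂ a).target, ∀ᶠ z in 𝓝 c, DifferentiableAt ℂ
      (fun z => w ((chartAt ℂ a).symm c) ((chartAt ℂ a).symm z)) z := by
    intro a c hc
    filter_upwards [eventually_comp_chart_symm hc (hd _),
      (chartAt ℂ a).open_target.mem_nhds hc] with z hz hz'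
    exact differentiableAt_comp_chart_symm hz' hz
  have hWa : ∀ a, ∀ c ∈ (chartAt ℂ a).target, AnalyticAt ℂ
      (fun z => w ((chartAt ℂ a).symm c) ((chartAt ℂ a).symm z)) c := fun a c hc =>
    Complex.analyticAt_iff_eventually_differentiableAt.mpr (hWd a c hc)
  have hWim : ∀ y, (w y y).im ≠ 0 := fun y => (him y).self_of_nhds.ne'
  -- Replacing `W` by `σ W + α` multiplies both `W'` and `Im W` by `σ`, so near `c` the branch based
  -- at the centre gives the same coefficient.
  have hGloc : ∀ a, ∀ c ∈ (chartAt ℂ a).target, G a =ᶠ[𝓝 c]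
      logForm (fun z => w ((chartAt ℂ a).symm c) ((chartAt ℂ a).symm z)) := by
    intro a c hc
    filter_upwards [eventually_comp_chart_symm hc (haff _),
      (chartAt ℂ a).open_target.mem_nhds hc] with z ⟨σ, α, hσ, h⟩ hz
    have h' := eventually_comp_chart_symm hz h
    have hσ' : (σ : ℂ) ≠ 0 := by exact_mod_cast hσ
    simp only [G, logForm]
    rw [Filter.EventuallyEq.deriv_eq h', h'.self_of_nhds, deriv_add_const, deriv_const_mul_field]
    simp only [Complex.add_im, Complex.im_ofReal_mul, Complex.ofReal_im,
      add_zero]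
    push_cast
    rw [mul_div_mul_left _ _ hσ']
  have hG : ∀ a, ContDiffOn ℝ 1 (G a) (chartAt ℂ a).target := fun a c hc =>
    ((contDiffAt_logForm (hWa a c hc) (hWim _)).congr_of_eventuallyEq
      (hGloc a c hc)).contDiffWithinAt
  have hGdbar : ∀ a, ∀ c ∈ (chartAt ℂ a).target,
      dbar (G a) c = -Complex.I * (‖G a c‖ ^ 2 : ℝ) := fun a c hc => by
    rw [dbar_congr (hGloc a c hc), dbar_logForm (hWa a c hc) (hWim _)]
  have hGt : ∀ a b, ∀ c ∈ ((chartAt ℂ a).symm ≫ₕ chartAt ℂ b).source,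
      G a c = G b (chartAt ℂ b ((chartAt ℂ a).symm c)) *
        deriv (fun z => chartAt ℂ b ((chartAt ℂ a).symm z)) c := by
    intro a b c hc
    have hcb : (chartAt ℂ a).symm c ∈ (chartAt ℂ b).source := hc.2
    have hτ : DifferentiableAt ℂ (fun z => chartAt ℂ b ((chartAt ℂ a).symm z)) c :=
      ((contDiffOn_transition (IsManifold.chart_mem_maximalAtlas a)
        (IsManifold.chart_mem_maximalAtlas b)).contDiffAt
        (((chartAt ℂ a).symm ≫ₕ chartAt ℂ b).open_source.mem_nhds hc)).differentiableAt (by simp)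
    have hW := (hWa b _ ((chartAt ℂ b).map_source hcb)).differentiableAt
    simp only [G, logForm]
    rw [(chartAt ℂ b).left_inv hcb] at hW ⊢
    have hcomp := deriv_comp c hW hτ
    rw [div_mul_eq_mul_div, ← hcomp]
    congr 1
    refine Filter.EventuallyEq.deriv_eq ?_
    filter_upwards [((chartAt ℂ a).symm ≫ₕ chartAt ℂ b).open_source.mem_nhds hc] with z hz
    have hz2 : (chartAt ℂ a).symm z ∈ (chartAt ℂ b).source := hz.2
    simp [(chartAt ℂ b).left_inv hz2]
  have : IsManifold 𝓘(ℝ, ℂ) ∞ X := isManifold_real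
  obtain ⟨ρ, hρ⟩ := SmoothPartitionOfUnity.exists_isSubordinate_chartAt_source 𝓘(ℝ, ℂ) X
  have hfin := ρ.locallyFinite.finite_nonempty_of_compact
  let u : Finset X := hfin.toFinset
  have hsum : ∀ p, ∑ a ∈ u, ρ a p = 1 := by
    intro p
    rw [← ρ.sum_eq_one (mem_univ p)]
    refine (finsum_eq_sum_of_support_subset _ fun a ha => ?_).symm
    exact hfin.mem_toFinset.mpr ⟨p, ha⟩
  have hstokes := sum_setIntegral_dbar_eq_zero G hG hGt u (fun a => ρ a)
    (fun a => (ρ a).contMDiff) hρ hsum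
  -- the integrands are of one sign, so they vanish
  let k : X → ℂ → ℝ := fun a c => ρ a ((chartAt ℂ a).symm c) * ‖G a c‖ ^ 2
  have hk0 : ∀ a c, 0 ≤ k a c := fun a c => mul_nonneg (ρ.nonneg a _) (sq_nonneg _)
  have hksum : ∑ a ∈ u, ∫ c in (chartAt ℂ a).target, k a c = 0 := by
    have h : ∀ a, ∫ c in (chartAt ℂ a).target, (ρ a ((chartAt ℂ a).symm c) : ℂ) * dbar (G a) c
        = -Complex.I * ((∫ c in (chartAt ℂ a).target, k a c : ℝ) : ℂ) := by
      intro a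
      rw [← integral_complex_ofReal, ← integral_const_mul]
      refine setIntegral_congr_fun (chartAt ℂ a).open_target.measurableSet fun c hc => ?_
      simp only [hGdbar a c hc, k]
      push_cast
      ring
    simp only [h] at hstokes
    rw [← Finset.mul_sum] at hstokes
    have := (mul_eq_zero.mp hstokes).resolve_left (neg_ne_zero.mpr Complex.I_ne_zero)
    exact_mod_cast this
  have hkc : ∀ a, ContinuousOn (k a) (chartAt ℂ a).target := fun a =>
    ((ρ a).contMDiff.continuous.comp_continuousOn (chartAt ℂ a).continuousOn_symm).mul
      ((hG a).continuousOn.norm.pow 2)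
  have hki : ∀ a, IntegrableOn (k a) (chartAt ℂ a).target := by
    intro a
    have h : IntegrableOn (fun c => (k a c : ℂ)) (chartAt ℂ a).target := by
      refine integrableOn_of_eq_zero_off_compact (Q := chartAt ℂ a '' tsupport (ρ a))
        (chartAt ℂ a).open_target ?_ ?_ (Complex.continuous_ofReal.comp_continuousOn (hkc a)) ?_
      · exact (isClosed_tsupport (ρ a)).isCompact.image_of_continuousOn
          ((chartAt ℂ a).continuousOn.mono (hρ a))
      · rintro _ ⟨p, hp, rfl⟩
        exact (chartAt ℂ a).map_source (hρ a hp)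
      · intro c hc hcQ
        have : (chartAt ℂ a).symm c ∉ tsupport (ρ a) := fun h =>
          hcQ ⟨_, h, (chartAt ℂ a).right_inv hc⟩
        simp [k, image_eq_zero_of_notMem_tsupport this]
    simpa [IntegrableOn] using h.re
  have hkz : ∀ a ∈ u, ∀ c ∈ (chartAt ℂ a).target, k a c = 0 := by
    intro a ha
    have h := (Finset.sum_eq_zero_iff_of_nonneg
      (fun a _ => integral_nonneg (hk0 a))).mp hksum a ha
    have hae := (integral_eq_zero_iff_of_nonneg (hk0 a) (hki a)).mp h
    -- A continuous function on an open set that vanishes almost everywhere vanishes identically.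
    exact Measure.eqOn_open_of_ae_eq hae (chartAt ℂ a).open_target (hkc a) continuousOn_const
  have hGz : ∀ b, ∀ c ∈ (chartAt ℂ b).target, G b c = 0 := by
    intro b c hc
    -- Some member of the partition is nonzero at the point; there `G a` vanishes, and the
    -- transformation rule carries this to the chart at `b`.
    obtain ⟨a, ha, hpa⟩ : ∃ a ∈ u, ρ a ((chartAt ℂ b).symm c) ≠ 0 := by
      by_contra! h
      have := hsum ((chartAt ℂ b).symm c)
      rw [Finset.sum_eq_zero h] at this
      exact zero_ne_one this
    have hsrc : (chartAt ℂ b).symm c ∈ (chartAt ℂ a).source := hρ a (subset_tsupport _ hpa)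
    have h := hkz a ha _ ((chartAt ℂ a).map_source hsrc)
    simp only [k, (chartAt ℂ a).left_inv hsrc] at h
    have h' := pow_eq_zero_iff two_ne_zero |>.mp ((mul_eq_zero.mp h).resolve_left hpa)
    rw [hGt b a c ⟨hc, hsrc⟩, norm_eq_zero.mp h', zero_mul]
  have hx := mem_chart_target ℂ x
  have hxx : (chartAt ℂ x).symm (chartAt ℂ x x) = x :=
    (chartAt ℂ x).left_inv (mem_chart_source ℂ x)
  have hder : ∀ᶠ z in 𝓝 (chartAt ℂ x x),
      deriv (fun z => w x ((chartAt ℂ x).symm z)) z = 0 := by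
    have hi := eventually_comp_chart_symm hx (him _)
    have hl := hGloc x _ hx
    rw [hxx] at hi hl
    filter_upwards [hi, hl, (chartAt ℂ x).open_target.mem_nhds hx] with z hz hz' hzt
    rw [hGz x z hzt] at hz'
    exact (div_eq_zero_iff.mp hz'.symm).resolve_right (by exact_mod_cast hz.ne')
  have hdx := hWd x _ hx
  rw [hxx] at hdx
  have hconst := eventually_const_of_eventually_deriv_eq_zero hdx hder
  rw [hxx] at hconst
  filter_upwards [((chartAt ℂ x).continuousAt (mem_chart_source ℂ x)).eventually hconst,
    (chartAt ℂ x).open_source.mem_nhds (mem_chart_source ℂ x)] with y hy hy'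
  rwa [(chartAt ℂ x).left_inv hy'] at hy

end RiemannSurface

/-! ### Holomorphic maps from compact Riemann surfaces to `M` -/

namespace OTData

variable {K : Type*} [Field K] [NumberField K] {s t : ℕ}

/-- Two charts of `M` differ locally by the action of an element of `U ⋉ O_K`. -/
lemma exists_eventually_chart_eq_affine (D : OTData K s t)
    {e e' : OpenPartialHomeomorph D.Manifold (Fin s ⊕ Fin t → ℂ)}
    (he : e ∈ atlas (Fin s ⊕ Fin t → ℂ) D.Manifold)
    (he' : e' ∈ atlas (Fin s ⊕ Fin t → ℂ) D.Manifold) {p : D.Manifold} (hp : p ∈ e.source)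
    (hp' : p ∈ e'.source) : ∃ γ : D.Gamma, ∀ᶠ q in 𝓝 p, e' q = D.affine γ (e q) := by
  obtain ⟨w, hw, hwp⟩ := D.proj_of_mem_target he hp
  obtain ⟨w', hw', hwp'⟩ := D.proj_of_mem_target he' hp'
  obtain ⟨γ, hγ⟩ := D.proj_eq_iff.mp (hwp'.trans hwp.symm)
  have hγp : D.affine γ (e p) = e' p := by
    rw [← hw', ← hγ, coe_smul, hw]
  refine ⟨γ, ?_⟩
  have hcont : ContinuousAt (fun q => D.affine γ (e q)) p :=
    (D.contDiff_affine γ).continuous.continuousAt.comp (e.continuousAt hp)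
  have hT : D.affine γ (e p) ∈ e'.target := hγp ▸ e'.map_source hp'
  filter_upwards [e.open_source.mem_nhds hp,
    hcont.preimage_mem_nhds (e'.open_target.mem_nhds hT)] with q hq hq'
  obtain ⟨v, hv, hvp⟩ := D.proj_of_mem_target he hq
  obtain ⟨v', hv', hvp'⟩ := D.proj_of_mem_target he' (e'.map_target hq')
  rw [e'.right_inv hq'] at hv'
  have h1 : v' = γ • v := Subtype.ext (by rw [hv', coe_smul, hv])
  have h2 : e'.symm (D.affine γ (e q)) = q := by
    rw [← hvp', ← hvp]
    exact D.proj_eq_iff.mpr ⟨γ, h1.symm⟩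
  have h3 := e'.right_inv hq'
  simp only [h2] at h3
  exact h3

/-- The leaves `{z} × ℂ^t` embed into `M`. -/
lemma eq_of_proj_eq_of_inl_eq (D : OTData K s t) {v v' : domain s t} (h : D.proj v = D.proj v')
    (hv : ∀ i : Fin s, (v : Fin s ⊕ Fin t → ℂ) (Sum.inl i) = (v' : Fin s ⊕ Fin t → ℂ) (Sum.inl i)) :
    v = v' := by
  obtain ⟨γ, rfl⟩ := D.proj_eq_iff.mp h
  let i : Fin s := ⟨0, D.s_pos⟩
  have h1 : D.affine γ v' (Sum.inl i) = (v' : Fin s ⊕ Fin t → ℂ) (Sum.inl i) := hv i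
  -- The translation `σ_i(a)` is real, so imaginary parts give `σ_i(u) = 1` and hence `u = 1`; what
  -- remains is `σ_i(a) = 0`, hence `a = 0`.
  have h2 := congrArg Complex.im h1
  rw [affine_inl_im] at h2
  have hu : D.unitPart γ = 1 := by
    apply (D.realEmb i).injective
    rw [map_one]
    exact mul_right_cancel₀ (v'.2 i).ne' (h2.trans (one_mul _).symm)
  have ha : D.transPart γ = 0 := by
    simp only [affine, hu, map_one, one_mul, add_eq_left] at h1
    exact (map_eq_zero _).mp h1
  have hγ : γ = 1 := D.gamma_ext (hu.trans (by simp [unitPart])) (ha.trans (by simp [transPart]))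
  rw [hγ, one_smul]

lemma affine_congr_apply (D : OTData K s t) (γ : D.Gamma) {z z' : Fin s ⊕ Fin t → ℂ}
    {k : Fin s ⊕ Fin t} (h : z k = z' k) : D.affine γ z k = D.affine γ z' k := by
  simp only [affine, h]

section Curves

/-- The local lift near `x` of a map `f : X → M` to `ℍ^s × ℂ^t`, given by the chart at `f x`. -/
def localLift {X : Type*} (D : OTData K s t) (f : X → D.Manifold) (x y : X) : Fin s ⊕ Fin t → ℂ :=
  chartAt (Fin s ⊕ Fin t → ℂ) (f x) (f y)

lemma exists_localLift_eq {X : Type*} (D : OTData K s t) {f : X → D.Manifold} {x y : X}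
    (hy : f y ∈ (chartAt (Fin s ⊕ Fin t → ℂ) (f x)).source) :
    ∃ v : domain s t, (v : Fin s ⊕ Fin t → ℂ) = D.localLift f x y ∧ D.proj v = f y :=
  D.proj_of_mem_target (chart_mem_atlas _ (f x)) hy

variable {X : Type*} [TopologicalSpace X] (D : OTData K s t) {f : X → D.Manifold}

lemma eventually_mem_chart_source (hf : Continuous f) (x : X) :
    ∀ᶠ y in 𝓝 x, f y ∈ (chartAt (Fin s ⊕ Fin t → ℂ) (f x)).source :=
  hf.continuousAt.preimage_mem_nhds (chart_source_mem_nhds _ (f x))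

variable [ChartedSpace ℂ X]

lemma mdifferentiableAt_localLift (hf : MDifferentiable 𝓘(ℂ, ℂ) 𝓘(ℂ, Fin s ⊕ Fin t → ℂ) f)
    {x y : X} (hy : f y ∈ (chartAt (Fin s ⊕ Fin t → ℂ) (f x)).source) :
    MDifferentiableAt 𝓘(ℂ, ℂ) 𝓘(ℂ, Fin s ⊕ Fin t → ℂ) (D.localLift f x) y := by
  have : IsManifold 𝓘(ℂ, Fin s ⊕ Fin t → ℂ) 1 D.Manifold := IsManifold.of_le (n := ω) le_top
  exact (mdifferentiableAt_atlas (I := 𝓘(ℂ, Fin s ⊕ Fin t → ℂ))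
    (chart_mem_atlas _ (f x)) hy).comp y (hf y)

/-- The components in `ℍ` of a holomorphic map from a compact Riemann surface to `M` are locally
constant. -/
lemma eventually_localLift_inl_eq [T2Space X] [CompactSpace X] [IsManifold 𝓘(ℂ, ℂ) ω X]
    (hf : MDifferentiable 𝓘(ℂ, ℂ) 𝓘(ℂ, Fin s ⊕ Fin t → ℂ) f) (x : X) :
    ∀ᶠ y in 𝓝 x, ∀ i : Fin s,
      D.localLift f x y (Sum.inl i) = D.localLift f x x (Sum.inl i) := by
  rw [eventually_all]
  intro i
  refine eventually_eq_of_affine_branches (fun x y => D.localLift f x y (Sum.inl i)) ?_ ?_ ?_ x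
  · intro x
    filter_upwards [D.eventually_mem_chart_source hf.continuous x] with y hy
    exact (ContinuousLinearMap.proj (R := ℂ) (φ := fun _ : Fin s ⊕ Fin t => ℂ)
      (Sum.inl i)).mdifferentiableAt.comp y (D.mdifferentiableAt_localLift hf hy)
  · intro x
    filter_upwards [D.eventually_mem_chart_source hf.continuous x] with y hy
    obtain ⟨v, hv, -⟩ := D.exists_localLift_eq hy
    rw [← hv]
    exact v.2 i
  · intro x
    filter_upwards [D.eventually_mem_chart_source hf.continuous x] with y hy
    obtain ⟨γ, hγ⟩ := D.exists_eventually_chart_eq_affine (chart_mem_atlas _ (f y))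
      (chart_mem_atlas _ (f x)) (mem_chart_source _ (f y)) hy
    -- The branches differ by an affine map with real coefficients because `σ_i` is a real
    -- embedding; its slope is nonzero by positivity of the units.
    refine ⟨D.realEmb i (D.unitPart γ), D.realEmb i (D.transPart γ), (D.unitPart_pos γ i).ne', ?_⟩
    filter_upwards [hf.continuous.continuousAt.eventually hγ] with y' hy'
    exact congrFun hy' (Sum.inl i)

/-- Every holomorphic map from a compact Riemann surface to `M` is locally constant. -/
theorem isLocallyConstant_of_mdifferentiable [T2Space X] [CompactSpace X]
    [IsManifold 𝓘(ℂ, ℂ) ω X] (hf : MDifferentiable 𝓘(ℂ, ℂ) 𝓘(ℂ, Fin s ⊕ Fin t → ℂ) f) :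
    IsLocallyConstant f := by
  rw [IsLocallyConstant.iff_eventually_eq]
  intro x₀
  -- The lifts of `f x` lying in the leaf through the local lift of `f x₀`; there is at most one.
  let IsLift : X → domain s t → Prop := fun x v =>
    (∀ i, (v : Fin s ⊕ Fin t → ℂ) (Sum.inl i) = D.localLift f x₀ x₀ (Sum.inl i)) ∧ D.proj v = f x
  have huniq : ∀ {x v v'}, IsLift x v → IsLift x v' → v = v' := fun hv hv' =>
    D.eq_of_proj_eq_of_inl_eq (hv.2.trans hv'.2.symm) fun i => (hv.1 i).trans (hv'.1 i).symm
  -- around a point, lifts to the leaf exist everywhere or nowhere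
  have hnear : ∀ x, ∀ᶠ y in 𝓝 x, ∀ γ : D.Gamma, ∀ (v v' : domain s t),
      (v : Fin s ⊕ Fin t → ℂ) = D.affine γ (D.localLift f x x) →
      (v' : Fin s ⊕ Fin t → ℂ) = D.affine γ (D.localLift f x y) → (IsLift x v ↔ IsLift y v') := by
    intro x
    filter_upwards [D.eventually_localLift_inl_eq hf x,
      D.eventually_mem_chart_source hf.continuous x] with y hy hys γ v v' hv hv'
    obtain ⟨m, hm, hmp⟩ := D.exists_localLift_eq (mem_chart_source _ (f x))
    obtain ⟨m', hm', hmp'⟩ := D.exists_localLift_eq hys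
    have hv1 : v = γ • m := Subtype.ext (by rw [hv, coe_smul, hm])
    have hv2 : v' = γ • m' := Subtype.ext (by rw [hv', coe_smul, hm'])
    have hp : D.proj v = f x := (D.proj_eq_iff.mpr ⟨γ, hv1.symm⟩).trans hmp
    have hp' : D.proj v' = f y := (D.proj_eq_iff.mpr ⟨γ, hv2.symm⟩).trans hmp'
    have heq : ∀ i, (v : Fin s ⊕ Fin t → ℂ) (Sum.inl i)
        = (v' : Fin s ⊕ Fin t → ℂ) (Sum.inl i) := fun i => by
      rw [hv, hv']
      exact D.affine_congr_apply γ (hy i).symm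
    simp only [IsLift, hp, hp', heq]
  have hex : ∀ x, ∀ᶠ y in 𝓝 x, ∀ v : domain s t, IsLift y v → ∃ γ : D.Gamma,
      (v : Fin s ⊕ Fin t → ℂ) = D.affine γ (D.localLift f x y) := by
    intro x
    filter_upwards [D.eventually_mem_chart_source hf.continuous x] with y hys v hv
    obtain ⟨m', hm', hmp'⟩ := D.exists_localLift_eq hys
    obtain ⟨γ, hγ⟩ := D.proj_eq_iff.mp (hv.2.trans hmp'.symm)
    exact ⟨γ, by rw [← hγ, coe_smul, hm']⟩
  have hdom : ∀ x, ∀ᶠ y in 𝓝 x, ∀ γ : D.Gamma, ∃ v : domain s t,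
      (v : Fin s ⊕ Fin t → ℂ) = D.affine γ (D.localLift f x y) := by
    intro x
    filter_upwards [D.eventually_mem_chart_source hf.continuous x] with y hys γ
    obtain ⟨m', hm', -⟩ := D.exists_localLift_eq hys
    exact ⟨γ • m', by rw [coe_smul, hm']⟩
  classical
  -- The lift to the leaf, extended by `0` to the points without one. The points with a lift form an
  -- open and closed set, so `V` is holomorphic on all of `X` even when `X` is disconnected.
  let V : X → Fin s ⊕ Fin t → ℂ := fun x => if h : ∃ v, IsLift x v then (h.choose : _) else 0
  have hV : ∀ {x v}, IsLift x v → V x = v := by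
    intro x v hv
    have h : ∃ v, IsLift x v := ⟨v, hv⟩
    simp only [V, dif_pos h]
    rw [huniq h.choose_spec hv]
  have hVd : MDifferentiable 𝓘(ℂ, ℂ) 𝓘(ℂ, Fin s ⊕ Fin t → ℂ) V := by
    intro x
    by_cases hx : ∃ v, IsLift x v
    · obtain ⟨v, hv⟩ := hx
      obtain ⟨γ, hγ⟩ := (hex x).self_of_nhds v hv
      have hev : V =ᶠ[𝓝 x] fun y => D.affine γ (D.localLift f x y) := by
        filter_upwards [hnear x, hdom x] with y hy hy'
        obtain ⟨v', hv'⟩ := hy' γ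
        rw [hV ((hy γ v v' hγ hv').mp hv), hv']
      refine MDifferentiableAt.congr_of_eventuallyEq ?_ hev
      exact ((D.contDiff_affine γ).differentiable (by simp)).mdifferentiable.mdifferentiableAt.comp
        x (D.mdifferentiableAt_localLift hf (mem_chart_source _ (f x)))
    · have hev : V =ᶠ[𝓝 x] fun _ => 0 := by
        filter_upwards [hnear x, hex x] with y hy hy'
        refine dif_neg ?_
        rintro ⟨v', hv'⟩
        obtain ⟨γ, hγ⟩ := hy' v' hv'
        obtain ⟨v, hv⟩ := (hdom x).self_of_nhds γ
        exact hx ⟨v, (hy γ v v' hv hγ).mpr hv'⟩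
      exact mdifferentiableAt_const.congr_of_eventuallyEq hev
  -- The maximum principle on the compact surface `X`.
  have hconst := hVd.isLocallyConstant.eventually_eq x₀
  obtain ⟨v₀, hv₀, hvp₀⟩ := D.exists_localLift_eq (mem_chart_source _ (f x₀))
  have hL₀ : IsLift x₀ v₀ := ⟨fun i => by rw [hv₀], hvp₀⟩
  obtain ⟨γ, hγ⟩ := (hex x₀).self_of_nhds v₀ hL₀
  filter_upwards [hconst, hnear x₀, hdom x₀] with y hy hy' hy''
  obtain ⟨v', hv'⟩ := hy'' γ
  have hLy := (hy' γ v₀ v' hγ hv').mp hL₀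
  rw [hV hLy, hV hL₀] at hy
  rw [← hLy.2, ← hL₀.2, Subtype.ext hy]

end Curves

end OTData

/-! ### One-dimensional submanifolds as Riemann surfaces -/

section Submanifold

variable {E : Type*} [NormedAddCommGroup E] [NormedSpace ℂ E] {M : Type*} [TopologicalSpace M]
  [ChartedSpace E M]

/-- A holomorphic chart of `M` around `p` in which `C` is the line spanned by a vector,
together with a linear coordinate on this line. -/
structure LineChart (C : Set M) (p : C) where
  /-- the chart of `M` -/
  chart : OpenPartialHomeomorph M E
  mem_maximalAtlas : chart ∈ IsManifold.maximalAtlas 𝓘(ℂ, E) ω M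
  mem_source : (p : M) ∈ chart.source
  /-- the vector spanning the line -/
  vec : E
  /-- a linear form which is a coordinate on the line -/
  coord : E →L[ℂ] ℂ
  coord_vec : coord vec = 1
  mem_iff : ∀ q ∈ chart.source, q ∈ C ↔ coord (chart q) • vec = chart q

lemma IsComplexSubmanifold.nonempty_lineChart {C : Set M}
    (hC : IsComplexSubmanifold (E := E) 1 C) (p : C) : Nonempty (LineChart (E := E) C p) := by
  obtain ⟨e, he, hp, W, hW, h⟩ := hC p p.2
  obtain ⟨v, hv0, hv⟩ := finrank_eq_one_iff'.mp hW
  -- A continuous linear form normalised on `v` is a coordinate on the line, which then consists of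
  -- the `z` with `π z • v = z`.
  obtain ⟨π, hπ⟩ := SeparatingDual.exists_eq_one (R := ℂ) (x := (v : E)) (by simpa using hv0)
  refine ⟨⟨e, he, hp, v, π, hπ, fun q hq => (h q hq).trans ⟨fun hqW => ?_, fun hq => ?_⟩⟩⟩
  · obtain ⟨c, hc⟩ := hv ⟨e q, hqW⟩
    have hc' : c • (v : E) = e q := congrArg Subtype.val hc
    simp [← hc', hπ]
  · rw [← hq]
    exact W.smul_mem _ v.2

namespace LineChart

variable {C : Set M} {p : C} (S : LineChart (E := E) C p)

lemma symm_mem {c : ℂ} (hc : c • S.vec ∈ S.chart.target) : S.chart.symm (c • S.vec) ∈ C := by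
  rw [S.mem_iff _ (S.chart.map_target hc), S.chart.right_inv hc]
  simp [S.coord_vec]

/-- The chart of `C` given by the coordinate on the line. -/
def toChart : OpenPartialHomeomorph C ℂ := by
  classical
  exact
  { toFun q := S.coord (S.chart q)
    invFun c := if hc : S.chart.symm (c • S.vec) ∈ C then ⟨_, hc⟩ else p
    source := {q | (q : M) ∈ S.chart.source}
    target := {c | c • S.vec ∈ S.chart.target}
    map_source' q hq := by
      have := (S.mem_iff q hq).mp q.2
      change S.coord (S.chart q) • S.vec ∈ S.chart.target
      rw [this]
      exact S.chart.map_source hq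
    map_target' c hc := by
      rw [dif_pos (S.symm_mem hc)]
      exact S.chart.map_target hc
    left_inv' q hq := by
      have h : S.chart.symm (S.coord (S.chart q) • S.vec) = q := by
        rw [(S.mem_iff q hq).mp q.2, S.chart.left_inv hq]
      have hm : S.chart.symm (S.coord (S.chart q) • S.vec) ∈ C := by
        rw [h]
        exact q.2
      rw [dif_pos hm]
      exact Subtype.ext h
    right_inv' c hc := by
      rw [dif_pos (S.symm_mem hc)]
      simp [S.chart.right_inv hc, S.coord_vec]
    open_source := S.chart.open_source.preimage continuous_subtype_val
    open_target := S.chart.open_target.preimage (by fun_prop)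
    continuousOn_toFun := S.coord.continuous.comp_continuousOn
      (S.chart.continuousOn.comp continuous_subtype_val.continuousOn fun _ hq => hq)
    continuousOn_invFun := by
      rw [IsInducing.subtypeVal.continuousOn_iff]
      have h : ContinuousOn (fun c : ℂ => S.chart.symm (c • S.vec))
          {c | c • S.vec ∈ S.chart.target} :=
        S.chart.continuousOn_symm.comp (Continuous.continuousOn (by fun_prop)) fun _ hc => hc
      refine h.congr fun c hc => ?_
      simp [S.symm_mem hc] }

lemma toChart_apply (q : C) : S.toChart q = S.coord (S.chart q) := rfl

lemma mem_toChart_source {q : C} : q ∈ S.toChart.source ↔ (q : M) ∈ S.chart.source := Iff.rfl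

lemma coe_toChart_symm {c : ℂ} (hc : c ∈ S.toChart.target) :
    (S.toChart.symm c : M) = S.chart.symm (c • S.vec) := by
  classical
  have h : S.toChart.symm c = if hc : S.chart.symm (c • S.vec) ∈ C then ⟨_, hc⟩ else p := rfl
  rw [h, dif_pos (S.symm_mem hc)]

/-- The complex structure on a one-dimensional submanifold. -/
@[reducible]
def chartedSpace (S : ∀ p : C, LineChart (E := E) C p) : ChartedSpace ℂ C where
  atlas := range fun p => (S p).toChart
  chartAt p := (S p).toChart
  mem_chart_source p := (S p).mem_source
  chart_mem_atlas p := ⟨p, rfl⟩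

/-- A transition map of `C` is a transition map of `M` preceded by the parametrisation `c ↦ c • vec`
of one line and followed by the linear coordinate of the other. -/
lemma isManifold [IsManifold 𝓘(ℂ, E) ω M] (S : ∀ p : C, LineChart (E := E) C p) :
    letI := chartedSpace S
    IsManifold 𝓘(ℂ, ℂ) ω C := by
  let := chartedSpace S
  refine isManifold_of_contDiffOn _ _ _ ?_
  rintro _ _ ⟨p, rfl⟩ ⟨p', rfl⟩
  simp only [modelWithCornersSelf_coe, modelWithCornersSelf_coe_symm, Set.range_id,
    Set.inter_univ, Set.preimage_id, Function.id_comp, Function.comp_id]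
  have hmaps : ∀ c ∈ ((S p).toChart.symm ≫ₕ (S p').toChart).source,
      c • (S p).vec ∈ ((S p).chart.symm ≫ₕ (S p').chart).source := by
    intro c hc
    have hc2 : (S p).toChart.symm c ∈ (S p').toChart.source := hc.2
    rw [mem_toChart_source, coe_toChart_symm _ hc.1] at hc2
    exact ⟨hc.1, hc2⟩
  have h : ContDiffOn ℂ ω
      (fun c : ℂ => (S p').coord ((S p').chart ((S p).chart.symm (c • (S p).vec))))
      ((S p).toChart.symm ≫ₕ (S p').toChart).source :=
    (S p').coord.contDiff.comp_contDiffOn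
      ((contDiffOn_transition (S p).mem_maximalAtlas (S p').mem_maximalAtlas).comp
        (contDiff_id.smul contDiff_const).contDiffOn hmaps)
  refine h.congr fun c hc => ?_
  change (S p').toChart ((S p).toChart.symm c) = _
  rw [toChart_apply, coe_toChart_symm _ hc.1]

lemma mdifferentiable_subtype_val [IsManifold 𝓘(ℂ, E) ω M]
    (S : ∀ p : C, LineChart (E := E) C p) :
    letI := chartedSpace S
    MDifferentiable 𝓘(ℂ, ℂ) 𝓘(ℂ, E) (Subtype.val : C → M) := by
  let := chartedSpace S
  have := isManifold S
  have : IsManifold 𝓘(ℂ, ℂ) 1 C := IsManifold.of_le (n := ω) le_top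
  intro p
  have h1 : MDifferentiableAt 𝓘(ℂ, ℂ) 𝓘(ℂ, ℂ) (S p).toChart p :=
    mdifferentiableAt_atlas (chart_mem_atlas ℂ p) (mem_chart_source ℂ p)
  have h2 : MDifferentiableAt 𝓘(ℂ, ℂ) 𝓘(ℂ, E) (fun c : ℂ => c • (S p).vec) ((S p).toChart p) :=
    (differentiableAt_id.smul_const _).mdifferentiableAt
  have hp : (S p).toChart p • (S p).vec = (S p).chart p :=
    ((S p).mem_iff p (S p).mem_source).mp p.2
  have h3 : MDifferentiableAt 𝓘(ℂ, E) 𝓘(ℂ, E) (S p).chart.symm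
      ((S p).toChart p • (S p).vec) := by
    rw [hp]
    exact ((contMDiffOn_symm_of_mem_maximalAtlas (S p).mem_maximalAtlas).contMDiffAt
      ((S p).chart.open_target.mem_nhds ((S p).chart.map_source (S p).mem_source))
      ).mdifferentiableAt (by simp)
  refine (h3.comp p (h2.comp p h1)).congr_of_eventuallyEq ?_
  filter_upwards [(S p).toChart.open_source.mem_nhds (S p).mem_source] with q hq
  have hq' := ((S p).mem_iff q hq).mp q.2
  change (q : M) = (S p).chart.symm ((S p).coord ((S p).chart q) • (S p).vec)
  rw [hq', (S p).chart.left_inv hq]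

/-- Otherwise `p` would be isolated in `C`, and its chart would make a point of `ℂ` isolated. -/
lemma not_isLocallyConstant_subtype_val {p : C} (S : LineChart (E := E) C p) :
    ¬ IsLocallyConstant (Subtype.val : C → M) := by
  intro h
  have h1 := h.eventually_eq p
  have hp : p ∈ S.toChart.source := S.mem_source
  have h2 := S.toChart.eventually_nhds' (fun q : C => (q : M) = p) hp
  have h3 : ∀ᶠ c in 𝓝 (S.toChart p), c = S.toChart p := by
    filter_upwards [h2.mpr h1, S.toChart.open_target.mem_nhds (S.toChart.map_source hp)]
      with c hc hct
    rw [← S.toChart.right_inv hct, Subtype.ext hc]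
  have h4 : ∀ᶠ c in 𝓝[≠] (S.toChart p), False := by
    rw [eventually_nhdsWithin_iff]
    filter_upwards [h3] with c hc hne
    exact hne hc
  exact h4.exists.elim fun _ => id

end LineChart

end Submanifold

end OeljeklausToma

end

/-- There are no compact complex curves on Oeljeklaus–Toma manifolds: there is no nonempty compact
one-dimensional complex submanifold, and, to cover singular curves as well, every holomorphic
map from a compact connected Riemann surface is constant. -/
theorem mainTheorem1 {K : Type*} [Field K] [NumberField K] {s t : ℕ}
    (D : OeljeklausToma.OTData K s t) :
    (¬ ∃ C : Set D.Manifold, C.Nonempty ∧ IsCompact C ∧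
      OeljeklausToma.IsComplexSubmanifold (E := Fin s ⊕ Fin t → ℂ) 1 C) ∧
    ∀ (X : Type*) [TopologicalSpace X] [T2Space X] [CompactSpace X] [ConnectedSpace X]
      [ChartedSpace ℂ X] [IsManifold 𝓘(ℂ, ℂ) ω X] (f : X → D.Manifold),
      MDifferentiable 𝓘(ℂ, ℂ) 𝓘(ℂ, Fin s ⊕ Fin t → ℂ) f → ∃ p, ∀ x, f x = p := by
  refine ⟨?_, ?_⟩
  · rintro ⟨C, ⟨p, hp⟩, hcomp, hC⟩
    -- A choice of line charts makes `C` a compact Riemann surface. It need not be connected, since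
    -- local constancy of the inclusion is already contradictory.
    let S : ∀ p : C, OeljeklausToma.LineChart (E := Fin s ⊕ Fin t → ℂ) C p := fun p =>
      (hC.nonempty_lineChart p).some
    let := OeljeklausToma.LineChart.chartedSpace S
    have := OeljeklausToma.LineChart.isManifold S
    have : CompactSpace C := isCompact_iff_compactSpace.mp hcomp
    exact (S ⟨p, hp⟩).not_isLocallyConstant_subtype_val
      (D.isLocallyConstant_of_mdifferentiable
        (OeljeklausToma.LineChart.mdifferentiable_subtype_val S))
  · intro X _ _ _ _ _ _ f hf
    obtain ⟨x₀⟩ := (inferInstance : Nonempty X)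
    exact ⟨f x₀, fun x =>
      (D.isLocallyConstant_of_mdifferentiable hf).apply_eq_of_preconnectedSpace x x₀⟩
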